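/- A \emph{path-length sequence} with $n$ components is a sequence $l=(l_1,\dots,l_n)$ of non-negative integers with $l_1\le\dots\le l_n$ and $\sum_{i=1}^n 2^{-l_i}=1$. The set of path-length sequences with $n$ components is partially ordered by the imbalance order: $l\trianglelefteq h$ if and only if $\sum_{i=1}^k 2^{-l_i}\le\sum_{i=1}^k 2^{-h_i}$ for all $1\le k\le n$. An element is called \emph{join-irreducible} if it covers exactly one element in this order. A finite (possibly empty) sequence of integers is \emph{constant} if it contains at most one value, and \emph{near-constant} if it contains at most two distinct values, and these, if there are two, differ by $1$. \textbf{Proposition 3.} A path-length sequence $l=(l_1,\dots,l_n)$ is join-irreducible if and only if it is not near-constant and it is a concatenation $l=uvw$ of three (possibly empty) sequences such that (i) both $u$ and $w$ are near-constant, and $v$ is strictly increasing; (ii) $uv$ is not the empty sequence, and if $w$ is not empty, then the last component of $uv$ is strictly less than the first component of $w$; (iii) if $w$ is not constant but its first two components are equal, then the value of these components is at least $\mathrm{last}(uv)+2$, where $\mathrm{last}(uv)$ is the last component of $uv$. -/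

import Mathlib

/-- The Kraft sum `2 ^ (-x₁) + ... + 2 ^ (-xₙ)` of a finite sequence of non-negative integers. -/
def kraftSum (x : List ℕ) : ℚ :=
  (x.map fun a => ((2 : ℚ) ^ a)⁻¹).sum

/-- Path-length sequences with `n` components: nondecreasing sequences of `n` non-negative
integers whose Kraft sum is `1`. -/
def PathLengthSeq (n : ℕ) : Type :=
  {l : List ℕ // l.length = n ∧ l.Pairwise (· ≤ ·) ∧ kraftSum l = 1}

theorem kraftSum_take_succ (x : List ℕ) (k : ℕ) (hk : k < x.length) :
    kraftSum (x.take (k + 1)) = kraftSum (x.take k) + ((2 : ℚ) ^ x[k])⁻¹ := by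
  unfold kraftSum
  rw [List.take_succ_eq_append_getElem hk, List.map_append, List.sum_append]
  simp only [List.map_cons, List.map_nil, List.sum_singleton]

theorem eq_of_kraftSum_take_eq (x y : List ℕ) (hlen : x.length = y.length)
    (h : ∀ k, kraftSum (x.take k) = kraftSum (y.take k)) : x = y := by
  apply List.ext_getElem hlen
  intro k hx hy
  have h1 := kraftSum_take_succ x k hx
  have h2 := kraftSum_take_succ y k hy
  rw [h (k + 1), h k, h2] at h1
  have h3 : (2 : ℚ) ^ y[k] = 2 ^ x[k] := inv_injective (add_left_cancel h1)
  exact (pow_right_injective₀ (by norm_num) (by norm_num) h3).symm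

/-- The imbalance order: `l ≤ h` (`l` is more balanced than `h`) iff every partial sum of
`2 ^ (-l₁), ..., 2 ^ (-lₙ)` is at most the corresponding partial sum for `h`. -/
instance PathLengthSeq.instPartialOrder (n : ℕ) : PartialOrder (PathLengthSeq n) where
  le l h := ∀ k : ℕ, kraftSum (l.1.take k) ≤ kraftSum (h.1.take k)
  le_refl _ _ := le_rfl
  le_trans _ _ _ h₁ h₂ k := (h₁ k).trans (h₂ k)
  le_antisymm l h h₁ h₂ := Subtype.ext <|
    eq_of_kraftSum_take_eq l.1 h.1 (l.2.1.trans h.2.1.symm)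
      fun k => le_antisymm (h₁ k) (h₂ k)

/-- An element is join-irreducible if it covers exactly one element. -/
def JoinIrreducibleElem {α : Type*} [PartialOrder α] (a : α) : Prop :=
  ∃! b : α, b ⋖ a

/-- At most one value occurs in the sequence. -/
def ConstantSeq (x : List ℕ) : Prop :=
  ∃ c : ℕ, ∀ a ∈ x, a = c

/-- At most two values occur in the sequence, and if there are two then they differ by `1`. -/
def NearConstantSeq (x : List ℕ) : Prop :=
  ∃ c : ℕ, ∀ a ∈ x, a = c ∨ a = c + 1

/-! An exchange replaces `p, q, q` with `p + 2 ≤ q` by `p + 1, p + 1, q - 1`. It keeps the length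
and the Kraft sum and moves strictly down in the order. The proof rests on two facts.

Every element strictly below `l` lies below some exchange of `l` (`exists_le_exchangeSum`), so lower
covers are exchanges. Two exchanges of `l` are comparable exactly when their intervals `[p, q]` are
nested, the smaller interval giving the larger element (`exchangeSum_mono`,
`le_and_le_of_exchangeSum_le`). Hence lower covers correspond to inclusion-minimal intervals. There
is exactly one of these iff some exchange exists and the left end of any interval and the right end
of any other again form an exchangeable pair (`joinIrreducibleElem_iff_exchangeable`).

The rest is combinatorics of values. Let `m` and `M` be the least and greatest components; `M` is
repeated by parity. If `c` is the least repeated value with `c ≥ m + 2`, the criterion says that no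
component lies in `[c - 1, M - 2]`. Cutting at `m + 2` and at `c` yields `u`, `v`, `w`. -/

/-- The component of a sequence at a (zero-based) position, `0` past the end. -/
def component (x : List ℕ) (i : ℕ) : ℕ := x.getD i 0

theorem component_eq_getElem {x : List ℕ} {i : ℕ} (hi : i < x.length) :
    component x i = x[i] := by
  simp [component, hi]

theorem component_mem {x : List ℕ} {i : ℕ} (hi : i < x.length) : component x i ∈ x := by
  rw [component_eq_getElem hi]; exact List.getElem_mem hi

theorem exists_component_of_mem {x : List ℕ} {a : ℕ} (ha : a ∈ x) :
    ∃ i < x.length, component x i = a := by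
  obtain ⟨i, hi, h⟩ := List.mem_iff_getElem.1 ha
  exact ⟨i, hi, by rw [component_eq_getElem hi, h]⟩

theorem component_mono {x : List ℕ} (hx : x.Pairwise (· ≤ ·)) {i j : ℕ} (hij : i ≤ j)
    (hj : j < x.length) : component x i ≤ component x j := by
  rw [component_eq_getElem hj, component_eq_getElem (hij.trans_lt hj)]
  rcases hij.eq_or_lt with rfl | h
  · exact le_rfl
  · exact List.pairwise_iff_getElem.1 hx i j _ hj h

theorem kraftSum_take_zero (x : List ℕ) : kraftSum (x.take 0) = 0 := by simp [kraftSum]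

theorem kraftSum_take_add_one {x : List ℕ} {k : ℕ} (hk : k < x.length) :
    kraftSum (x.take (k + 1)) = kraftSum (x.take k) + ((2 : ℚ) ^ component x k)⁻¹ := by
  rw [kraftSum_take_succ x k hk, component_eq_getElem hk]

/-! ### Positions of values in a nondecreasing sequence -/

/-- The number of components that are at most `c`. -/
def countLE (x : List ℕ) (c : ℕ) : ℕ := x.countP (· ≤ c)

theorem countLE_le_length (x : List ℕ) (c : ℕ) : countLE x c ≤ x.length := List.countP_le_length

theorem countLE_mono (x : List ℕ) {c d : ℕ} (h : c ≤ d) : countLE x c ≤ countLE x d :=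
  List.countP_mono_left fun a _ ha => by
    simp only [decide_eq_true_eq] at ha ⊢; omega

theorem component_le_iff {x : List ℕ} (hx : x.Pairwise (· ≤ ·)) {i : ℕ} (hi : i < x.length)
    (c : ℕ) : component x i ≤ c ↔ i < countLE x c := by
  induction x generalizing i with
  | nil => simp at hi
  | cons a x ih =>
    rw [List.pairwise_cons] at hx
    by_cases hac : a ≤ c
    · cases i with
      | zero => simp [component, countLE, hac]
      | succ i =>
        have := ih hx.2 (i := i) (by simpa using hi)
        simpa [component, countLE, hac] using this
    · have h0 : x.countP (· ≤ c) = 0 := by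
        rw [List.countP_eq_zero]
        intro b hb
        have := hx.1 b hb
        simp only [decide_eq_true_eq]; omega
      have h1 : a ≤ component (a :: x) i := by
        have := component_mem hi
        rw [List.mem_cons] at this
        rcases this with h | h
        · exact h.ge
        · exact hx.1 _ h
      have h2 : countLE (a :: x) c = 0 := by
        simp only [countLE, List.countP_cons, h0]; simp [hac]
      rw [h2]; omega

/-- In a nondecreasing sequence, the last occurrence of `p` is at position `countLE x p - 1`. -/
theorem component_countLE_sub_one {x : List ℕ} (hx : x.Pairwise (· ≤ ·)) {p : ℕ} (hp : p ∈ x) :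
    0 < countLE x p ∧ component x (countLE x p - 1) = p := by
  obtain ⟨i, hi, h⟩ := exists_component_of_mem hp
  have h1 := (component_le_iff hx hi p).1 h.le
  have hlen := countLE_le_length x p
  have h2 := (component_le_iff hx (i := countLE x p - 1) (by omega) p).2 (by omega)
  have h3 := component_mono hx (i := i) (j := countLE x p - 1) (by omega) (by omega)
  exact ⟨by omega, by omega⟩

/-- In a nondecreasing sequence, the first two occurrences of a repeated value `q` follow the
components that are less than `q`. -/
theorem component_countLE_of_duplicate {x : List ℕ} (hx : x.Pairwise (· ≤ ·)) {q : ℕ}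
    (hq : x.Duplicate q) (hq0 : 0 < q) :
    countLE x (q - 1) + 1 < x.length ∧ component x (countLE x (q - 1)) = q ∧
      component x (countLE x (q - 1) + 1) = q := by
  obtain ⟨i, j, hij, hi, hj⟩ := List.duplicate_iff_exists_distinct_get.1 hq
  have hi' : component x i = q := by rw [component_eq_getElem i.2]; exact hi.symm
  have hj' : component x j = q := by rw [component_eq_getElem j.2]; exact hj.symm
  have hij' : (i : ℕ) < j := hij
  have hjl := j.2
  have h1 := component_le_iff hx i.2 (q - 1)
  have hb : countLE x (q - 1) ≤ i := by omega
  have h2 := component_le_iff hx (i := countLE x (q - 1)) (by omega) (q - 1)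
  have h3 := component_mono hx (i := countLE x (q - 1)) (j := countLE x (q - 1) + 1)
    (by omega) (by omega)
  have h4 := component_mono hx (i := countLE x (q - 1) + 1) (j := j) (by omega) hjl
  exact ⟨by omega, by omega, by omega⟩

theorem duplicate_of_component_eq {x : List ℕ} {q i : ℕ} (hi : i + 1 < x.length)
    (h1 : component x i = q) (h2 : component x (i + 1) = q) : x.Duplicate q := by
  rw [component_eq_getElem (by omega)] at h1 h2
  exact List.duplicate_iff_exists_distinct_get.2
    ⟨⟨i, Nat.lt_of_succ_lt hi⟩, ⟨i + 1, hi⟩, by simp [Fin.lt_def], h1.symm, h2.symm⟩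

/-! ### Dyadic divisibility of initial Kraft sums -/

theorem exists_kraftSum_eq_mul (x : List ℕ) {N : ℕ} (h : ∀ a ∈ x, a ≤ N) :
    ∃ m : ℤ, kraftSum x = m * ((2 : ℚ) ^ N)⁻¹ := by
  induction x with
  | nil => exact ⟨0, by simp [kraftSum]⟩
  | cons a x ih =>
    obtain ⟨m, hm⟩ := ih fun b hb => h b (List.mem_cons_of_mem _ hb)
    obtain ⟨d, rfl⟩ := Nat.exists_eq_add_of_le (h a List.mem_cons_self)
    refine ⟨2 ^ d + m, ?_⟩
    have : kraftSum (a :: x) = ((2 : ℚ) ^ a)⁻¹ + kraftSum x := by simp [kraftSum]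
    rw [this, hm]
    push_cast
    rw [add_mul, pow_add]
    field_simp

theorem exists_kraftSum_take_eq_mul {x : List ℕ} (hx : x.Pairwise (· ≤ ·)) {k N : ℕ}
    (hk : k < x.length) (h : component x k ≤ N) :
    ∃ m : ℤ, kraftSum (x.take (k + 1)) = m * ((2 : ℚ) ^ N)⁻¹ := by
  apply exists_kraftSum_eq_mul
  intro a ha
  obtain ⟨i, hi, rfl⟩ := List.mem_iff_getElem.1 ha
  rw [List.getElem_take, ← component_eq_getElem]
  rw [List.length_take] at hi
  exact (component_mono hx (by omega) hk).trans h

/-- If the Kraft sum of an initial segment that ends in `q` is a multiple of `2 ^ (-(q - 1))`,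
then its last two components are equal. -/
theorem component_eq_of_kraftSum_take_eq_mul {x : List ℕ} (hx : x.Pairwise (· ≤ ·)) {k N : ℕ}
    (hk : k < x.length) (h : component x k = N + 1) {m : ℤ}
    (hm : kraftSum (x.take (k + 1)) = m * ((2 : ℚ) ^ N)⁻¹) :
    0 < k ∧ component x (k - 1) = N + 1 := by
  -- Parity: the component at `k` contributes an odd multiple of `2 ^ (-(N + 1))`, so the sum before
  -- it cannot also be a multiple of `2 ^ (-N)`.
  have key : ∀ m' : ℤ, kraftSum (x.take k) ≠ m' * ((2 : ℚ) ^ N)⁻¹ := by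
    intro m' hm'
    rw [kraftSum_take_add_one hk, h, hm', pow_succ] at hm
    have h1 : (2 : ℚ) ^ N ≠ 0 := by positivity
    field_simp at hm
    have h2 : m' * 2 + 1 = 2 * m := by
      have : ((m' * 2 + 1 : ℤ) : ℚ) = ((2 * m : ℤ) : ℚ) := by push_cast; linarith
      exact_mod_cast this
    omega
  have hk0 : 0 < k := by
    rcases Nat.eq_zero_or_pos k with rfl | h0
    · exact absurd (by rw [kraftSum_take_zero]; simp) (key 0)
    · exact h0
  obtain ⟨k, rfl⟩ : ∃ j, k = j + 1 := ⟨k - 1, by omega⟩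
  refine ⟨hk0, ?_⟩
  by_contra hne
  have h1 := component_mono hx (Nat.le_succ k) hk
  simp only [Nat.add_sub_cancel, Nat.succ_eq_add_one] at hne h1
  obtain ⟨m', hm'⟩ := exists_kraftSum_take_eq_mul hx (k := k) (N := N) (by omega) (by omega)
  exact key m' hm'

/-! ### Exchanges -/

/-- The initial Kraft sums after replacing, in `x`, one `p` and two `q`s by two `p + 1`s and one
`q - 1`. -/
def exchangeSum (x : List ℕ) (p q k : ℕ) : ℚ :=
  if k < countLE x p then kraftSum (x.take k)
  else if k = countLE x p then kraftSum (x.take k) - ((2 : ℚ) ^ (p + 1))⁻¹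
  else if k ≤ countLE x (q - 1) + 1 then kraftSum (x.take (k - 1))
  else kraftSum (x.take k)

/-- The pairs `(p, q)` to which an exchange applies. -/
def Exchangeable (x : List ℕ) (p q : ℕ) : Prop := p ∈ x ∧ x.Duplicate q ∧ p + 2 ≤ q

theorem two_mul_inv_two_pow_succ (p : ℕ) :
    ((2 : ℚ) ^ (p + 1))⁻¹ + ((2 : ℚ) ^ (p + 1))⁻¹ = ((2 : ℚ) ^ p)⁻¹ := by
  rw [pow_succ]; field_simp; norm_num

theorem exists_exchange {n : ℕ} (l : PathLengthSeq n) {p q : ℕ} (h : Exchangeable l.1 p q) :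
    ∃ e : PathLengthSeq n, ∀ k, kraftSum (e.1.take k) = exchangeSum l.1 p q k := by
  obtain ⟨x, hlen, hx, hsum⟩ := l
  obtain ⟨hp, hq, hpq⟩ := h
  simp only at hp hq ⊢
  obtain ⟨ha0, hpa⟩ := component_countLE_sub_one hx hp
  obtain ⟨hb, hqb, hqb1⟩ := component_countLE_of_duplicate hx hq (by omega)
  have hab := countLE_mono x (c := p) (d := q - 1) (by omega)
  have hle1 := fun i hi => component_le_iff hx (i := i) hi p
  have hle2 := fun i hi => component_le_iff hx (i := i) hi (q - 1)
  have hmono := fun i j hij hj => component_mono hx (i := i) (j := j) hij hj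
  unfold exchangeSum
  generalize countLE x p = a at *
  generalize countLE x (q - 1) = b at *
  -- The last `p` is at `a - 1` and the first two `q`s are at `b` and `b + 1`. The extra `p + 1`
  -- pushes the components at `a, ..., b - 1` one place to the right, and merging the two `q`s
  -- absorbs the shift. Acting on the last `p` and the first `q`s keeps the sequence nondecreasing.
  let g : ℕ → ℕ := fun k =>
    if k < a - 1 then component x k
    else if k ≤ a then p + 1
    else if k ≤ b then component x (k - 1)
    else if k = b + 1 then q - 1
    else component x k
  let y : List ℕ := List.ofFn fun i : Fin n => g i
  have hy : y.length = n := List.length_ofFn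
  have hyg : ∀ i, i < n → component y i = g i := by
    intro i hi
    rw [component_eq_getElem (by omega)]
    simp [y]
  have hys : y.Pairwise (· ≤ ·) := by
    rw [List.pairwise_iff_getElem]
    intro i j hi hj hij
    rw [← component_eq_getElem, ← component_eq_getElem, hyg i (by omega), hyg j (by omega)]
    have h1 := hmono i j hij.le (by omega)
    have h2 := hmono (i - 1) (j - 1) (by omega) (by omega)
    have h3 := hmono i (j - 1) (by omega) (by omega)
    have h4 := hmono (i - 1) j (by omega) (by omega)
    have h5 := hle1 i (by omega)
    have h6 := hle1 (j - 1) (by omega)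
    have h7 := hle2 (i - 1) (by omega)
    have h8 := hle2 j (by omega)
    have h9 := hle1 j (by omega)
    simp only [g]
    split_ifs <;> omega
  have key : ∀ k, k ≤ n → kraftSum (y.take k) =
      if k < a then kraftSum (x.take k)
      else if k = a then kraftSum (x.take k) - ((2 : ℚ) ^ (p + 1))⁻¹
      else if k ≤ b + 1 then kraftSum (x.take (k - 1))
      else kraftSum (x.take k) := by
    intro k
    induction k with
    | zero => intro _; simp [ha0]
    | succ k ih =>
      intro hk
      rw [kraftSum_take_add_one (by omega), ih (by omega), hyg k (by omega)]
      have hP := two_mul_inv_two_pow_succ p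
      have hxk := kraftSum_take_add_one (x := x) (k := k) (by omega)
      rcases lt_or_ge (k + 1) a with h1 | h1
      · simp only [g, if_pos h1, if_pos (show k < a by omega), if_pos (show k < a - 1 by omega)]
        rw [hxk]
      rcases h1.eq_or_lt with h1 | h1
      · have : component x k = p := by rw [← hpa]; congr 1; omega
        simp only [g, if_pos (show k < a by omega), if_neg (show ¬ k < a - 1 by omega),
          if_pos (show k ≤ a by omega), if_neg (show ¬ k + 1 < a by omega), if_pos h1.symm]
        rw [hxk, this]; linarith
      rcases (show a ≤ k by omega).eq_or_lt with h2 | h2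
      · simp only [g, if_neg (show ¬ k < a by omega), if_neg (show ¬ k < a - 1 by omega),
          if_pos (show k ≤ a by omega), if_neg (show ¬ k + 1 < a by omega), if_pos h2.symm,
          if_neg (show ¬ k + 1 = a by omega), if_pos (show k + 1 ≤ b + 1 by omega),
          Nat.add_sub_cancel]
        ring
      obtain ⟨k, rfl⟩ : ∃ j, k = j + 1 := ⟨k - 1, by omega⟩
      have hxk' := kraftSum_take_add_one (x := x) (k := k) (by omega)
      simp only [g, if_neg (show ¬ k + 1 < a by omega), if_neg (show ¬ k + 1 < a - 1 by omega),
        if_neg (show ¬ k + 1 ≤ a by omega), if_neg (show ¬ k + 1 + 1 < a by omega),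
        if_neg (show ¬ k + 1 = a by omega), if_neg (show ¬ k + 1 + 1 = a by omega),
        Nat.add_sub_cancel]
      rcases lt_or_ge k b with h3 | h3
      · simp only [if_pos (show k + 1 ≤ b by omega), if_pos (show k + 1 ≤ b + 1 by omega),
          if_pos (show k + 1 + 1 ≤ b + 1 by omega)]
        rw [hxk']
      rcases h3.eq_or_lt with h4 | h4
      · subst h4
        have hQ := two_mul_inv_two_pow_succ (q - 1)
        rw [show q - 1 + 1 = q by omega] at hQ
        simp only [if_neg (show ¬ b + 1 ≤ b by omega), if_pos (le_refl (b + 1)),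
          if_neg (show ¬ b + 1 + 1 ≤ b + 1 by omega), if_true]
        rw [hxk, hxk', hqb, hqb1]; linarith
      · simp only [if_neg (show ¬ k + 1 ≤ b by omega), if_neg (show ¬ k + 1 ≤ b + 1 by omega),
          if_neg (show ¬ k + 1 + 1 ≤ b + 1 by omega), if_neg (show ¬ k + 1 = b + 1 by omega)]
        rw [hxk]
  -- Since `b + 1 < n`, the full sum falls in the last case and is still `1`.
  have hn := key n le_rfl
  rw [if_neg (by omega), if_neg (by omega), if_neg (by omega),
    List.take_of_length_le (by omega), List.take_of_length_le (by omega), hsum] at hn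
  refine ⟨⟨y, hy, hys, hn⟩, fun k => ?_⟩
  rcases le_total k n with hk | hk
  · exact key k hk
  · simp only
    rw [if_neg (by omega), if_neg (by omega), if_neg (by omega),
      List.take_of_length_le (by omega), List.take_of_length_le (by omega), hsum, hn]

/-! ### Comparison of exchanges -/

theorem kraftSum_take_sub_one_le (x : List ℕ) (k : ℕ) :
    kraftSum (x.take (k - 1)) ≤ kraftSum (x.take k) := by
  rcases Nat.eq_zero_or_pos k with rfl | hk
  · exact le_rfl
  obtain ⟨k, rfl⟩ : ∃ j, k = j + 1 := ⟨k - 1, by omega⟩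
  rw [Nat.add_sub_cancel]
  rcases lt_or_ge k x.length with h | h
  · rw [kraftSum_take_add_one h]
    exact le_add_of_nonneg_right (by positivity)
  · rw [List.take_of_length_le h, List.take_of_length_le (by omega)]

theorem exchangeSum_le (x : List ℕ) (p q k : ℕ) :
    exchangeSum x p q k ≤ kraftSum (x.take k) := by
  unfold exchangeSum
  have := kraftSum_take_sub_one_le x k
  have : (0 : ℚ) < ((2 : ℚ) ^ (p + 1))⁻¹ := by positivity
  split_ifs <;> linarith

theorem le_and_le_of_exchangeSum_lt {x : List ℕ} {p q k : ℕ}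
    (h : exchangeSum x p q k < kraftSum (x.take k)) :
    countLE x p ≤ k ∧ (k = countLE x p ∨ k ≤ countLE x (q - 1) + 1) := by
  unfold exchangeSum at h
  split_ifs at h with h1 h2 h3
  · exact absurd h (lt_irrefl _)
  · exact ⟨by omega, Or.inl h2⟩
  · exact ⟨by omega, Or.inr h3⟩
  · exact absurd h (lt_irrefl _)

theorem exchangeSum_countLE_lt (x : List ℕ) (p q : ℕ) :
    exchangeSum x p q (countLE x p) < kraftSum (x.take (countLE x p)) := by
  unfold exchangeSum
  rw [if_neg (lt_irrefl _), if_pos rfl]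
  have : (0 : ℚ) < ((2 : ℚ) ^ (p + 1))⁻¹ := by positivity
  linarith

/-- A wider interval shifts the partial sums over a longer range. The only delicate index is the
last `p'`: the narrow exchange loses half of `2 ^ (-p')` there, while the wide one, if `p < p'`,
loses all of it. -/
theorem exchangeSum_mono {x : List ℕ} (hx : x.Pairwise (· ≤ ·)) {p q p' q' : ℕ}
    (hp : p ∈ x) (h' : Exchangeable x p' q') (hpp : p ≤ p') (hqq : q' ≤ q) (k : ℕ) :
    exchangeSum x p q k ≤ exchangeSum x p' q' k := by
  obtain ⟨hp', -, hpq'⟩ := h'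
  obtain ⟨ha, hpa⟩ := component_countLE_sub_one hx hp
  obtain ⟨ha', hpa'⟩ := component_countLE_sub_one hx hp'
  have h1 := countLE_mono x hpp
  have h2 := countLE_mono x (c := p') (d := q' - 1) (by omega)
  have h3 := countLE_mono x (c := q' - 1) (d := q - 1) (by omega)
  have hlen := countLE_le_length x p'
  rcases lt_or_ge k (countLE x p') with hk | hk
  · exact (exchangeSum_le x p q k).trans_eq (by rw [exchangeSum, if_pos hk])
  rcases hk.eq_or_lt with hk | hk
  · subst hk
    conv_rhs => rw [exchangeSum, if_neg (lt_irrefl _), if_pos rfl]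
    rcases h1.eq_or_lt with h4 | h4
    · have : p = p' := by rw [← hpa, ← hpa', h4]
      subst this
      rw [exchangeSum, if_neg (lt_irrefl _), if_pos rfl]
    · rw [exchangeSum, if_neg (by omega), if_neg (by omega), if_pos (by omega)]
      have h5 := kraftSum_take_add_one (x := x) (k := countLE x p' - 1) (by omega)
      rw [hpa', Nat.sub_add_cancel (by omega)] at h5
      have h6 := two_mul_inv_two_pow_succ p'
      have : (0 : ℚ) < ((2 : ℚ) ^ (p' + 1))⁻¹ := by positivity
      linarith
  rcases le_or_gt k (countLE x (q' - 1) + 1) with hk' | hk'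
  · rw [exchangeSum, if_neg (by omega), if_neg (by omega), if_pos (by omega),
      exchangeSum, if_neg (by omega), if_neg (by omega), if_pos (by omega)]
  · refine (exchangeSum_le x p q k).trans_eq ?_
    rw [exchangeSum, if_neg (by omega), if_neg (by omega), if_neg (by omega)]

/-- The indices where an exchange lowers the partial sums run from the last `p` to the second `q`. A
smaller exchange must also be lower at both ends of the range of the larger one, which forces the
intervals to be nested. -/
theorem le_and_le_of_exchangeSum_le {x : List ℕ} (hx : x.Pairwise (· ≤ ·)) {p q p' q' : ℕ}
    (h : Exchangeable x p q) (h' : Exchangeable x p' q')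
    (hle : ∀ k, exchangeSum x p q k ≤ exchangeSum x p' q' k) : p ≤ p' ∧ q' ≤ q := by
  obtain ⟨hp, hq, hpq⟩ := h
  obtain ⟨hp', hq', hpq'⟩ := h'
  obtain ⟨ha, hpa⟩ := component_countLE_sub_one hx hp
  obtain ⟨ha', hpa'⟩ := component_countLE_sub_one hx hp'
  obtain ⟨hb, hqb, -⟩ := component_countLE_of_duplicate hx hq (by omega)
  obtain ⟨hb', hqb', -⟩ := component_countLE_of_duplicate hx hq' (by omega)
  have hlen := countLE_le_length x p'
  have h2 := countLE_mono x (c := p') (d := q' - 1) (by omega)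
  have h3 := countLE_mono x (c := p) (d := q - 1) (by omega)
  constructor
  · have h1 := (le_and_le_of_exchangeSum_lt
      ((hle _).trans_lt (exchangeSum_countLE_lt x p' q'))).1
    have := component_mono hx (i := countLE x p - 1) (j := countLE x p' - 1) (by omega) (by omega)
    omega
  · have h1 : exchangeSum x p' q' (countLE x (q' - 1) + 1) <
        kraftSum (x.take (countLE x (q' - 1) + 1)) := by
      rw [exchangeSum, if_neg (by omega), if_neg (by omega), if_pos le_rfl, Nat.add_sub_cancel,
        kraftSum_take_add_one (by omega)]
      exact lt_add_of_pos_right _ (by positivity)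
    have h4 := (le_and_le_of_exchangeSum_lt ((hle _).trans_lt h1)).2
    have := component_mono hx (i := countLE x (q' - 1)) (j := countLE x (q - 1))
      (by omega) (by omega)
    omega

/-! ### Elements below `l` lie below an exchange of `l` -/

theorem inv_two_pow_anti {i j : ℕ} (h : i ≤ j) : ((2 : ℚ) ^ j)⁻¹ ≤ ((2 : ℚ) ^ i)⁻¹ :=
  inv_anti₀ (by positivity) (pow_le_pow_right₀ (by norm_num) h)

theorem lt_of_inv_two_pow_lt {i j : ℕ} (h : ((2 : ℚ) ^ j)⁻¹ < ((2 : ℚ) ^ i)⁻¹) : i < j := by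
  by_contra hc
  exact absurd (inv_two_pow_anti (not_lt.1 hc)) (not_le.2 h)

theorem add_inv_le_of_lt_of_eq_mul {a b : ℚ} {N : ℕ} {m m' : ℤ} (ha : a = m * ((2 : ℚ) ^ N)⁻¹)
    (hb : b = m' * ((2 : ℚ) ^ N)⁻¹) (h : a < b) : a + ((2 : ℚ) ^ N)⁻¹ ≤ b := by
  subst ha hb
  have h0 : (0 : ℚ) < ((2 : ℚ) ^ N)⁻¹ := by positivity
  have h1 : m < m' := by exact_mod_cast lt_of_mul_lt_mul_right h h0.le
  have h2 : (m : ℚ) + 1 ≤ m' := by exact_mod_cast h1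
  nlinarith

/-- Every sequence strictly below `l` lies below an exchange applied to `l`. -/
theorem exists_le_exchangeSum {n : ℕ} {h l : PathLengthSeq n} (hl : h < l) :
    ∃ p q, Exchangeable l.1 p q ∧
      ∀ k, kraftSum (h.1.take k) ≤ exchangeSum l.1 p q k := by
  have hle : ∀ k, kraftSum (h.1.take k) ≤ kraftSum (l.1.take k) := hl.le
  have hex : ∃ k, kraftSum (h.1.take k) < kraftSum (l.1.take k) := by
    by_contra hc
    push Not at hc
    exact absurd hl (not_lt_of_ge hc)
  obtain ⟨y, hylen, hy, hysum⟩ := h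
  obtain ⟨x, hxlen, hx, hxsum⟩ := l
  simp only at hle hex ⊢
  clear hl
  classical
  -- The indices from `a` to `b - 1` form the first maximal run on which the partial sums of `y` are
  -- strictly smaller. The components of `x` entered at its two ends supply `p` and `q = r + 1`.
  obtain ⟨a, ha, hamin⟩ : ∃ a, kraftSum (y.take a) < kraftSum (x.take a) ∧
      ∀ k < a, kraftSum (y.take k) = kraftSum (x.take k) :=
    ⟨Nat.find hex, Nat.find_spec hex, fun k hk =>
      le_antisymm (hle k) (not_lt.1 (Nat.find_min hex hk))⟩
  have heq : ∀ k, n ≤ k → kraftSum (y.take k) = kraftSum (x.take k) := fun k hk => by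
    rw [List.take_of_length_le (by omega), List.take_of_length_le (by omega), hxsum, hysum]
  have han : a < n := by
    by_contra hc
    exact absurd (heq a (by omega)) ha.ne
  have ha0 : a ≠ 0 := by
    rintro rfl
    simp at ha
  obtain ⟨b, hab, hbn, hb, hbmin⟩ : ∃ b, a < b ∧ b ≤ n ∧
      kraftSum (y.take b) = kraftSum (x.take b) ∧
      ∀ k, a ≤ k → k < b → kraftSum (y.take k) < kraftSum (x.take k) := by
    have hex2 : ∃ b, a < b ∧ kraftSum (y.take b) = kraftSum (x.take b) := ⟨n, han, heq n le_rfl⟩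
    refine ⟨Nat.find hex2, (Nat.find_spec hex2).1, Nat.find_min' hex2 ⟨han, heq n le_rfl⟩,
      (Nat.find_spec hex2).2, fun k hk hk2 => ?_⟩
    rcases hk.eq_or_lt with rfl | hk
    · exact ha
    · exact (hle k).lt_of_ne fun hc => Nat.find_min hex2 hk2 ⟨hk, hc⟩
  clear hex heq
  obtain ⟨i, rfl⟩ : ∃ i, a = i + 1 := ⟨a - 1, by omega⟩
  obtain ⟨j, rfl⟩ : ∃ j, b = j + 1 := ⟨b - 1, by omega⟩
  have hi1 := hamin i (by omega)
  have hj1 := hbmin j (by omega) (by omega)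
  have hyi : component x i < component y i := by
    apply lt_of_inv_two_pow_lt
    rw [kraftSum_take_add_one (by omega), kraftSum_take_add_one (by omega)] at ha
    linarith
  have hyj : component y j < component x j := by
    apply lt_of_inv_two_pow_lt
    rw [kraftSum_take_add_one (by omega), kraftSum_take_add_one (by omega)] at hb
    linarith
  have hyij := component_mono hy (i := i) (j := j) (by omega) (by omega)
  obtain ⟨p, hp⟩ : ∃ p, component x i = p := ⟨_, rfl⟩
  obtain ⟨r, hr⟩ : ∃ r, component x j = r + 1 := ⟨component x j - 1, by omega⟩
  have hpx : p ∈ x := hp ▸ component_mem (by omega)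
  -- The common sum at the end of the run is a multiple of `2 ^ (-r)`, because the components of `y`
  -- up to there are at most `r`. By parity `x` then ends this segment with two equal components.
  obtain ⟨m, hm⟩ := exists_kraftSum_take_eq_mul hy (k := j) (N := r) (by omega) (by omega)
  obtain ⟨hj0, hr'⟩ := component_eq_of_kraftSum_take_eq_mul hx (by omega) hr (hb ▸ hm)
  have hdup : x.Duplicate (r + 1) :=
    duplicate_of_component_eq (i := j - 1) (by omega) hr' (by
      rw [Nat.sub_add_cancel (by omega)]; exact hr)
  refine ⟨p, r + 1, ⟨hpx, hdup, by omega⟩, ?_⟩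
  obtain ⟨hA0, hpA⟩ := component_countLE_sub_one hx hpx
  have hAi := (component_le_iff hx (i := i) (by omega) p).1 hp.le
  have hBj := component_le_iff hx (i := j - 1) (by omega) r
  have hAB := countLE_mono x (c := p) (d := r) (by omega)
  have hrr : r + 1 - 1 = r := rfl
  have hBj' : countLE x r + 1 ≤ j := by omega
  have hAlen := countLE_le_length x p
  unfold exchangeSum
  rw [hrr]
  have hgt : ∀ k, countLE x p ≤ k → k < n → p + 1 ≤ component x k := fun k hk hkn => by
    have := component_le_iff hx (i := k) (by omega) p
    omega
  have hygt : ∀ k, i ≤ k → k < n → p + 1 ≤ component y k := fun k hk hkn => by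
    have := component_mono hy hk (by omega)
    omega
  generalize countLE x p = A at *
  generalize countLE x r = B at *
  have hA : kraftSum (y.take A) + ((2 : ℚ) ^ (p + 1))⁻¹ ≤ kraftSum (x.take A) := by
    obtain ⟨A, rfl⟩ : ∃ k, A = k + 1 := ⟨A - 1, by omega⟩
    rw [Nat.add_sub_cancel] at hpA
    rw [kraftSum_take_add_one (by omega), kraftSum_take_add_one (by omega), hpA]
    have h1 := hle A
    have h2 := inv_two_pow_anti (hygt A (by omega) (by omega))
    have h3 := two_mul_inv_two_pow_succ p
    linarith
  -- Inside the run `y` lags a whole term behind `x`. If the new component of `y` is at most that of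
  -- `x`, both sums are multiples of the term of `x`, so the strict inequality has a gap of at least
  -- that term. Otherwise the new term of `y` is at most the preceding term of `x`, and induction
  -- applies.
  have main : ∀ k, A ≤ k → k ≤ B → kraftSum (y.take (k + 1)) ≤ kraftSum (x.take k) := by
    intro k hk
    induction k, hk using Nat.le_induction with
    | base =>
      intro hkB
      rw [kraftSum_take_add_one (by omega)]
      have := inv_two_pow_anti (hygt A (by omega) (by omega))
      linarith
    | succ k hk ih =>
      intro hkB
      have ih := ih (by omega)
      rcases le_or_gt (component y (k + 1)) (component x (k + 1)) with hc | hc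
      · obtain ⟨m1, hm1⟩ := exists_kraftSum_take_eq_mul hy (k := k + 1) (by omega) hc
        obtain ⟨m2, hm2⟩ := exists_kraftSum_take_eq_mul hx (k := k + 1) (by omega) le_rfl
        have h1 := add_inv_le_of_lt_of_eq_mul hm1 hm2 (hbmin (k + 1 + 1) (by omega) (by omega))
        rw [kraftSum_take_add_one (x := x) (k := k + 1) (by omega)] at h1
        linarith
      · have h1 := component_mono hx (i := k) (j := k + 1) (by omega) (by omega)
        have h2 := inv_two_pow_anti (h1.trans hc.le)
        rw [kraftSum_take_add_one (x := y) (k := k + 1) (by omega),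
          kraftSum_take_add_one (x := x) (k := k) (by omega)]
        linarith
  intro k
  split_ifs with h1 h2 h3
  · exact hle k
  · subst h2; linarith
  · have := main (k - 1) (by omega) (by omega)
    rwa [Nat.sub_add_cancel (by omega)] at this
  · exact hle k

theorem lt_of_kraftSum_eq_exchangeSum {n : ℕ} {l e : PathLengthSeq n} {p q : ℕ}
    (he : ∀ k, kraftSum (e.1.take k) = exchangeSum l.1 p q k) : e < l := by
  have h1 : e ≤ l := fun k => (he k).trans_le (exchangeSum_le l.1 p q k)
  refine lt_of_le_of_ne h1 ?_
  rintro rfl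
  exact (exchangeSum_countLE_lt e.1 p q).ne (he _).symm

/-! ### Minimal exchanges and lower covers -/

/-- The interval between `p` and `q` contains no other exchangeable pair. -/
def MinimalExchangeable (x : List ℕ) (p q : ℕ) : Prop :=
  Exchangeable x p q ∧
    ∀ p' q', Exchangeable x p' q' → p ≤ p' → q' ≤ q → p' = p ∧ q' = q

theorem exists_minimalExchangeable {x : List ℕ} {p q : ℕ} (h : Exchangeable x p q) :
    ∃ p' q', MinimalExchangeable x p' q' ∧ p ≤ p' ∧ q' ≤ q := by
  obtain ⟨d, hd⟩ : ∃ d, q - p = d := ⟨_, rfl⟩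
  induction d using Nat.strong_induction_on generalizing p q with
  | _ d ih =>
    by_cases hmin : MinimalExchangeable x p q
    · exact ⟨p, q, hmin, le_rfl, le_rfl⟩
    · simp only [MinimalExchangeable, h, true_and] at hmin
      push Not at hmin
      obtain ⟨p1, q1, h1, hp1, hq1, hne⟩ := hmin
      have h2 := h1.2.2
      have h3 := h.2.2
      have h4 : q1 - p1 < d := by
        by_cases hpp : p1 = p
        · have := hne hpp
          omega
        · omega
      obtain ⟨p2, q2, h5, h6, h7⟩ := ih _ h4 h1 rfl
      exact ⟨p2, q2, h5, hp1.trans h6, h7.trans hq1⟩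

/-- An element strictly between would lie below another exchange, whose interval would be nested in
the minimal one and hence equal to it. -/
theorem covBy_of_minimalExchangeable {n : ℕ} {l e : PathLengthSeq n} {p q : ℕ}
    (h : MinimalExchangeable l.1 p q)
    (he : ∀ k, kraftSum (e.1.take k) = exchangeSum l.1 p q k) : e ⋖ l := by
  refine ⟨lt_of_kraftSum_eq_exchangeSum he, fun c hec hcl => ?_⟩
  obtain ⟨p', q', h', hc⟩ := exists_le_exchangeSum hcl
  have hle : ∀ k, exchangeSum l.1 p q k ≤ exchangeSum l.1 p' q' k := fun k =>
    (he k).symm.trans_le ((hec.le k).trans (hc k))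
  obtain ⟨h1, h2⟩ := le_and_le_of_exchangeSum_le l.2.2.1 h.1 h' hle
  obtain ⟨rfl, rfl⟩ := h.2 p' q' h' h1 h2
  exact absurd hec (not_lt_of_ge fun k => (hc k).trans_eq (he k).symm)

theorem joinIrreducibleElem_iff_exchangeable {n : ℕ} (l : PathLengthSeq n) :
    JoinIrreducibleElem l ↔ (∃ p q, Exchangeable l.1 p q) ∧
      ∀ p q p' q', Exchangeable l.1 p q → Exchangeable l.1 p' q' → p + 2 ≤ q' := by
  constructor
  · rintro ⟨b, hb, huniq⟩
    obtain ⟨p, q, hpq, hbe⟩ := exists_le_exchangeSum hb.lt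
    obtain ⟨p0, q0, hmin, -, -⟩ := exists_minimalExchangeable hpq
    obtain ⟨e0, he0⟩ := exists_exchange l hmin.1
    have hb0 := huniq e0 (covBy_of_minimalExchangeable hmin he0)
    -- All minimal pairs give the same unique cover, so every exchangeable interval contains `[p0,
    -- q0]`.
    have key : ∀ p q, Exchangeable l.1 p q → p ≤ p0 ∧ q0 ≤ q := by
      intro p q h
      obtain ⟨p1, q1, hmin1, h2, h3⟩ := exists_minimalExchangeable h
      obtain ⟨e1, he1⟩ := exists_exchange l hmin1.1
      have hb1 := huniq e1 (covBy_of_minimalExchangeable hmin1 he1)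
      have := le_and_le_of_exchangeSum_le l.2.2.1 hmin1.1 hmin.1 fun k => by
        rw [← he1, ← he0, hb0, hb1]
      exact ⟨h2.trans this.1, this.2.trans h3⟩
    refine ⟨⟨p, q, hpq⟩, fun p q p' q' h h' => ?_⟩
    have h1 := (key p q h).1
    have h2 := (key p' q' h').2
    have h3 := hmin.1.2.2
    omega
  · rintro ⟨⟨p, q, hpq⟩, hcross⟩
    obtain ⟨p0, q0, hmin, -, -⟩ := exists_minimalExchangeable hpq
    obtain ⟨e, he⟩ := exists_exchange l hmin.1
    have hcov := covBy_of_minimalExchangeable hmin he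
    refine ⟨e, hcov, fun b hb => ?_⟩
    obtain ⟨p1, q1, h1, hbe⟩ := exists_le_exchangeSum hb.lt
    -- If `p1 > p0`, the crossing condition would make `(p1, q0)` exchangeable, strictly inside the
    -- minimal interval. The bound for `q1` is symmetric.
    have hp : p1 ≤ p0 := by
      by_contra hc
      have := (hmin.2 p1 q0 ⟨h1.1, hmin.1.2.1, hcross _ _ _ _ h1 hmin.1⟩ (by omega) le_rfl).1
      omega
    have hq : q0 ≤ q1 := by
      by_contra hc
      have := (hmin.2 p0 q1 ⟨hmin.1.1, h1.2.1, hcross _ _ _ _ hmin.1 h1⟩ le_rfl (by omega)).2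
      omega
    have hle : b ≤ e := fun k =>
      ((hbe k).trans (exchangeSum_mono l.2.2.1 h1.1 hmin.1 hp hq k)).trans_eq (he k).symm
    by_contra hne
    exact hb.2 (lt_of_le_of_ne hle hne) hcov.lt

/-! ### The shape of join-irreducible sequences -/

/-- In a path-length sequence that is not near-constant, the greatest component is repeated, and
it exceeds the least component by at least `2`. -/
theorem exists_min_max_of_not_nearConstantSeq {n : ℕ} (l : PathLengthSeq n)
    (hnc : ¬ NearConstantSeq l.1) :
    ∃ m M, (∀ a ∈ l.1, m ≤ a) ∧ (∀ a ∈ l.1, a ≤ M) ∧ m ∈ l.1 ∧ l.1.Duplicate M ∧ m + 2 ≤ M := by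
  obtain ⟨x, hlen, hx, hsum⟩ := l
  simp only at hnc ⊢
  have hpos : 0 < x.length := by
    rw [List.length_pos_iff]
    rintro rfl
    exact hnc ⟨0, by simp⟩
  have hmin : ∀ a ∈ x, component x 0 ≤ a := by
    intro a ha
    obtain ⟨i, hi, rfl⟩ := exists_component_of_mem ha
    exact component_mono hx (Nat.zero_le i) hi
  have hmax : ∀ a ∈ x, a ≤ component x (x.length - 1) := by
    intro a ha
    obtain ⟨i, hi, rfl⟩ := exists_component_of_mem ha
    exact component_mono hx (by omega) (by omega)
  have hgap : component x 0 + 2 ≤ component x (x.length - 1) := by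
    by_contra hc
    refine hnc ⟨component x 0, fun a ha => ?_⟩
    have := hmin a ha
    have := hmax a ha
    omega
  refine ⟨_, _, hmin, hmax, component_mem hpos, ?_, hgap⟩
  obtain ⟨N, hN⟩ : ∃ N, component x (x.length - 1) = N + 1 :=
    ⟨component x (x.length - 1) - 1, by omega⟩
  -- The total sum `1` is a multiple of `2 ^ (-N)`, so parity forces the greatest component `N + 1`
  -- to be repeated.
  have h1 : kraftSum (x.take (x.length - 1 + 1)) = ((2 ^ N : ℤ) : ℚ) * ((2 : ℚ) ^ N)⁻¹ := by
    rw [Nat.sub_add_cancel hpos, List.take_length, hsum]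
    push_cast
    rw [mul_inv_cancel₀ (by positivity)]
  obtain ⟨h2, h3⟩ := component_eq_of_kraftSum_take_eq_mul hx (by omega) hN h1
  exact hN ▸ duplicate_of_component_eq (i := x.length - 1 - 1) (by omega) h3
    (by rw [Nat.sub_add_cancel h2]; exact hN)

theorem eq_filter_lt_append_filter_ge {x : List ℕ} (hx : x.Pairwise (· ≤ ·)) (c : ℕ) :
    x = x.filter (· < c) ++ x.filter (c ≤ ·) := by
  induction x with
  | nil => rfl
  | cons a x ih =>
    rw [List.pairwise_cons] at hx
    by_cases hac : a < c
    · have := ih hx.2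
      simp [hac, ← this]
    · have h1 : (a :: x).filter (· < c) = [] := by
        rw [List.filter_eq_nil_iff]
        intro b hb
        have : a ≤ b := by
          rcases List.mem_cons.1 hb with rfl | hb
          · exact le_rfl
          · exact hx.1 b hb
        simp only [decide_eq_true_eq]; omega
      have h2 : (a :: x).filter (c ≤ ·) = a :: x := by
        rw [List.filter_eq_self]
        intro b hb
        have : a ≤ b := by
          rcases List.mem_cons.1 hb with rfl | hb
          · exact le_rfl
          · exact hx.1 b hb
        simp only [decide_eq_true_eq]; omega
      rw [h1, h2, List.nil_append]

theorem pairwise_lt_of_not_duplicate {x : List ℕ} (hx : x.Pairwise (· ≤ ·))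
    (h : ∀ a, ¬ x.Duplicate a) : x.Pairwise (· < ·) :=
  (hx.and (List.nodup_iff_forall_not_duplicate.2 h)).imp fun h => lt_of_le_of_ne h.1 h.2

theorem proposition3 (n : ℕ) (l : PathLengthSeq n) :
    JoinIrreducibleElem l ↔
      ¬ NearConstantSeq l.1 ∧
      ∃ u v w : List ℕ, l.1 = u ++ v ++ w ∧
        (NearConstantSeq u ∧ NearConstantSeq w ∧ v.Pairwise (· < ·)) ∧
        ∃ huv : u ++ v ≠ [],
          (∀ hw : w ≠ [], (u ++ v).getLast huv < w.head hw) ∧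
          (∀ (a : ℕ) (t : List ℕ), w = a :: a :: t → ¬ ConstantSeq w →
            (u ++ v).getLast huv + 2 ≤ a) := by
  rw [joinIrreducibleElem_iff_exchangeable]
  constructor
  · rintro ⟨⟨p, q, hp, hq, hpq⟩, hcross⟩
    have hnc : ¬ NearConstantSeq l.1 := by
      rintro ⟨c, hc⟩
      have h1 := hc p hp
      have h2 := hc q hq.mem
      omega
    obtain ⟨m, M, hmin, hmax, hm, hM, hmM⟩ := exists_min_max_of_not_nearConstantSeq l hnc
    refine ⟨hnc, ?_⟩
    have hsorted := l.2.2.1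
    generalize l.1 = x at *
    classical
    have hex : ∃ q, x.Duplicate q ∧ m + 2 ≤ q := ⟨M, hM, hmM⟩
    obtain ⟨c, hc, hmc, hcmin⟩ : ∃ c, x.Duplicate c ∧ m + 2 ≤ c ∧
        ∀ q, x.Duplicate q → m + 2 ≤ q → c ≤ q :=
      ⟨Nat.find hex, (Nat.find_spec hex).1, (Nat.find_spec hex).2,
        fun q h1 h2 => Nat.find_min' hex ⟨h1, h2⟩⟩
    -- The pairs `(p, M)` and `(m, c)` are crossed. Thus a component that is at least `c` must be `M
    -- - 1` or `M`.
    have hkey : ∀ p ∈ x, p + 2 ≤ M → p + 2 ≤ c := fun p hp hpM =>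
      hcross p M m c ⟨hp, hM, hpM⟩ ⟨hm, hc, hmc⟩
    have hsub : (x.filter (· < c)).Sublist x := List.filter_sublist
    have hs1 := hsorted.sublist hsub
    have heq : x.filter (· < c) = (x.filter (· < c)).filter (· < m + 2) ++
        (x.filter (· < c)).filter (m + 2 ≤ ·) := eq_filter_lt_append_filter_ge hs1 _
    have hne : x.filter (· < c) ≠ [] := by
      apply List.ne_nil_of_mem (a := m)
      rw [List.mem_filter]
      exact ⟨hm, by simp only [decide_eq_true_eq]; omega⟩
    have hw : ∀ a ∈ x.filter (c ≤ ·), a ∈ x ∧ c ≤ a := fun a ha => by simpa using ha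
    have hlast : ∀ h, (x.filter (· < c)).getLast h ∈ x ∧ (x.filter (· < c)).getLast h < c :=
      fun h => by
        have := List.getLast_mem h
        rw [List.mem_filter] at this
        exact ⟨this.1, by simpa using this.2⟩
    refine ⟨(x.filter (· < c)).filter (· < m + 2), (x.filter (· < c)).filter (m + 2 ≤ ·),
      x.filter (c ≤ ·), ?_, ⟨⟨m, fun a ha => ?_⟩, ⟨M - 1, fun a ha => ?_⟩, ?_⟩, ?_⟩
    · rw [← heq]
      exact eq_filter_lt_append_filter_ge hsorted c
    · simp only [List.mem_filter, decide_eq_true_eq] at ha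
      have := hmin a ha.1.1
      omega
    · obtain ⟨h1, h2⟩ := hw a ha
      have h3 := hkey a h1
      have h4 := hmax a h1
      omega
    · apply pairwise_lt_of_not_duplicate (hs1.sublist List.filter_sublist)
      intro a ha
      have h1 := ha.mem
      simp only [List.mem_filter, decide_eq_true_eq] at h1
      have h2 := hcmin a (ha.mono_sublist (List.filter_sublist.trans hsub)) h1.2
      omega
    · rw [← heq]
      refine ⟨hne, fun hw0 => ?_, fun a t hwt hconst => ?_⟩
      · exact (hlast hne).2.trans_le (hw _ (List.head_mem hw0)).2
      · have ha := hw a (by rw [hwt]; exact List.mem_cons_self)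
        have h1 := hlast hne
        -- If `w` began with `M` it would be constant. So `a < M`, and the last component of `uv`,
        -- being less than `c ≤ a`, is at most `M - 2`; now `hkey` applies to it.
        have haM : a ≠ M := by
          rintro rfl
          refine hconst ⟨a, fun b hb => le_antisymm (hmax b (hw b hb).1) ?_⟩
          have h2 : (x.filter (c ≤ ·)).Pairwise (· ≤ ·) := hsorted.sublist List.filter_sublist
          rw [hwt] at h2 hb
          rcases List.mem_cons.1 hb with rfl | hb
          · exact le_rfl
          · exact (List.pairwise_cons.1 h2).1 b hb
        have h2 := hmax a ha.1
        have h3 := hkey _ h1.1 (by omega)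
        omega
  · rintro ⟨hnc, u, v, w, hx, ⟨⟨c, hu⟩, ⟨d, hw⟩, hv⟩, huv, hlt, hw2⟩
    obtain ⟨m, M, hmin, hmax, hm, hM, hmM⟩ := exists_min_max_of_not_nearConstantSeq l hnc
    refine ⟨⟨m, M, hm, hM, hmM⟩, ?_⟩
    rintro p q' p' q ⟨hp, hq', hpq'⟩ ⟨hp', hq, hpq⟩
    have hpM := hpq'.trans (hmax q' hq'.mem)
    have hmq : m + 2 ≤ q := (Nat.add_le_add_right (hmin p' hp') 2).trans hpq
    have hsorted := l.2.2.1
    generalize l.1 = x at *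
    subst hx
    obtain ⟨huvs, hws, -⟩ := List.pairwise_append.1 hsorted
    have huvlast : ∀ a ∈ u ++ v, a ≤ (u ++ v).getLast huv := by
      intro a ha
      have h1 := huvs
      rw [← List.dropLast_append_getLast huv, List.pairwise_append] at h1
      rw [← List.dropLast_append_getLast huv, List.mem_append] at ha
      rcases ha with ha | ha
      · exact h1.2.2 a ha _ List.mem_cons_self
      · exact (List.mem_singleton.1 ha).le
    have hwhead : ∀ (hw0 : w ≠ []), ∀ a ∈ w, w.head hw0 ≤ a := by
      intro hw0 a ha
      cases w with
      | nil => exact absurd rfl hw0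
      | cons b w =>
        rcases List.mem_cons.1 ha with rfl | ha
        · exact le_rfl
        · exact (List.pairwise_cons.1 hws).1 a ha
    have hsep : ∀ a ∈ u ++ v, ∀ b ∈ w, a < b := fun a ha b hb =>
      have hw0 := List.ne_nil_of_mem hb
      (huvlast a ha).trans_lt ((hlt hw0).trans_le (hwhead hw0 b hb))
    -- A nonempty `u` starts with `m`, and `q ≥ m + 2` is too far from `m` for a near-constant
    -- sequence. As `v` is strictly increasing and lies below `w`, both copies of `q` end up in `w`.
    have hqu : q ∉ u := by
      intro hqu
      have hmu : m ∈ u := by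
        cases u with
        | nil => simp at hqu
        | cons b u =>
          have h1 : b ≤ m := by
            simp only [List.cons_append, List.mem_cons] at hm
            rw [List.cons_append, List.cons_append, List.pairwise_cons] at hsorted
            rcases hm with rfl | hm
            · exact le_rfl
            · exact hsorted.1 m hm
          have h2 := hmin b (by simp)
          rw [le_antisymm h2 h1]
          exact List.mem_cons_self
      have h1 := hu q hqu
      have h2 := hu m hmu
      omega
    have hcount := List.duplicate_iff_two_le_count.1 hq
    rw [List.count_append, List.count_append, List.count_eq_zero_of_not_mem hqu] at hcount
    have hvc := List.nodup_iff_count_le_one.1 (hv.imp fun h => ne_of_lt h) q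
    have hqw : q ∈ w := by
      rw [← List.count_pos_iff]; omega
    have hqv : q ∉ v := fun hqv =>
      lt_irrefl q (hsep q (List.mem_append_right _ hqv) q hqw)
    rw [List.count_eq_zero_of_not_mem hqv] at hcount
    have hMw : M ∈ w := by
      rcases List.mem_append.1 hM.mem with h | h
      · have h1 := hsep M h q hqw
        have h2 := hmax q hq.mem
        omega
      · exact h
    rcases List.mem_append.1 hp with hp | hp
    · have h1 := huvlast p hp
      have h2 := hsep p hp q hqw
      cases w with
      | nil => simp at hqw
      | cons a w =>
        have h3 := hlt (List.cons_ne_nil _ _)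
        rw [List.head_cons] at h3
        have h4 := hwhead (List.cons_ne_nil _ _) q hqw
        rw [List.head_cons] at h4
        -- Only `q` equal to the first component of `w` is critical. Then `w` starts with `q, q`: if
        -- `w` is constant, `q = M` and `p + 2 ≤ M` suffices; otherwise condition (iii) gives the
        -- bound.
        rcases h4.eq_or_lt with rfl | h4
        · rw [List.count_cons_self] at hcount
          cases w with
          | nil => simp at hcount
          | cons b w =>
            have h5 : a ∈ b :: w := by rw [← List.count_pos_iff]; omega
            have h6 : b ≤ a := by
              rw [List.pairwise_cons, List.pairwise_cons] at hws
              rcases List.mem_cons.1 h5 with rfl | h5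
              · exact le_rfl
              · exact hws.2.1 a h5
            have h7 := (List.pairwise_cons.1 hws).1 b List.mem_cons_self
            obtain rfl : a = b := le_antisymm h7 h6
            by_cases hconst : ConstantSeq (a :: a :: w)
            · obtain ⟨e, he⟩ := hconst
              have := he M hMw
              have := he a List.mem_cons_self
              omega
            · have := hw2 a w rfl hconst
              omega
        · omega
    -- Here `p` and `M` both lie in the near-constant `w`, contradicting `p + 2 ≤ M`.
    · have h1 := hw p hp
      have h2 := hw M hMw
      omega
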